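/- **FROCC.** Let $K:\mathbb{R}^d\times\mathbb{R}^d\to\mathbb{R}$ be a (measurable) kernel function, e.g. the dot product, let $m\ge 1$ be an integer and $\varepsilon\in(0,1]$. Given training points $x_1,\dots,x_n\in\mathbb{R}^d$, FROCC draws $m$ independent unit vectors $w_1,\dots,w_m$, each uniform on the unit sphere of $\mathbb{R}^d$ and independent of the training points. For each $i$ the values $K(w_i,x_1),\dots,K(w_i,x_n)$ are shifted and scaled into $(0,1)$ and put in increasing order $y_1\le\dots\le y_n$; $R_i$ is the set of intervals $[y_j,y_l]$, $j\le l$, such that $y_{t+1}-y_t<\varepsilon$ for $j\le t<l$, $y_j-y_{j-1}>\varepsilon$ if $j>1$, and $y_{l+1}-y_l>\varepsilon$ if $l<n$. A query $y\in\mathbb{R}^d$ is answered YES (label $1$) if for every $i$ the value $K(w_i,y)$, shifted and scaled in the same way, lies in some interval of $R_i$, and NO (label $0$) otherwise. **Risks.** Let $D$ be a probability distribution on $\mathbb{R}^d\times\{0,1\}$ (labels are arbitrary; the one-class setting is the case where $D$-almost every point has label $1$), and let the training set $S=(z_1,\dots,z_n)$, $|S|=n\ge 1$, be drawn i.i.d.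 from $D$. FROCC is run on the data parts of $z_1,\dots,z_n$. For $z=(x,y)$ let $V(A_S,z)$ be the probability, over $w_1,\dots,w_m$, that FROCC trained on $S$ does not answer $y$ at $x$. Put $R_e(\mathrm{FROCC},S)=\frac1n\sum_{k=1}^n V(A_S,z_k)$ and $R(\mathrm{FROCC},S)=\mathbb{E}_{S,z}[V(A_S,z)]$, where $z\sim D$ is independent of $S$. **Spatial divisibility.** A distribution $\mu$ on $\mathbb{R}^d$ is spatially divisible if it has a density and, for $X_1,\dots,X_d,Y$ drawn independently from $\mu$ and all measurable $A,B\subseteq\mathbb{R}^d$ with $\mu(A),\mu(B)>0$, $$\Pr[Y\in H_{X+}\mid X_1,\dots,X_d\in A,\ Y\in B]>0\quad\text{and}\quad \Pr[Y\in H_{X-}\mid X_1,\dots,X_d\in A,\ Y\in B]>0,$$ where $H_{X+}$ and $H_{X-}$ are the two open half-spaces bounded by the hyperplane through $X_1,\dots,X_d$, labelled by the sign of $\det\big((X_i-y)_{i=1}^d\big)$ for $y$ in the half-space. **Theorem 2.** If the distribution of the data part of $D$ is spatially divisible, then for FROCC with $\varepsilon=1$ the empirical risk converges in probability to the risk, exponentially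 fast in $|S|$: the expectation defining the risk exists for every $n\ge1$, and there are constants $C,c>0$ (which may depend on $D$, $m$, $K$, $d$ and the normalization rule, but not on $n$ or $t$) such that for all $n\ge 1$ and all $t>0$ $$\Pr_{S\sim D^n}\big[\,|R_e(\mathrm{FROCC},S)-R(\mathrm{FROCC},S)|>t\,\big]\le C\,e^{-c\,n\,t^2}.$$ -/

import Mathlib

open MeasureTheory ProbabilityTheory
open scoped ENNReal

noncomputable section

namespace FROCC

/-- The data space `ℝ^d` with its Euclidean structure. -/
abbrev Pt (d : ℕ) : Type := EuclideanSpace ℝ (Fin d)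

/-- Labelled points `z = (dat z, lab z)`; label `1` is `true`, label `0` is `false`. -/
abbrev LPt (d : ℕ) : Type := Pt d × Bool

/-- The unit vectors of `ℝ^d`. -/
abbrev Dir (d : ℕ) : Type := Metric.sphere (0 : Pt d) 1

/-! ### Spatial divisibility -/

/-- The determinant of the `d × d` matrix with rows `x₁ - y, …, x_d - y`. It vanishes exactly when
`y` and the points `x₁, …, x_d` lie on a common hyperplane, and as a function of `y` it is affine. -/
def side {d : ℕ} (x : Fin d → Pt d) (y : Pt d) : ℝ :=
  Matrix.det (Matrix.of fun i j : Fin d => x i j - y j)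

/-- One of the two open half-spaces bounded by the hyperplane through `x₁, …, x_d`. -/
def halfPos {d : ℕ} (x : Fin d → Pt d) : Set (Pt d) := {y | 0 < side x y}

/-- The other open half-space bounded by the hyperplane through `x₁, …, x_d`. -/
def halfNeg {d : ℕ} (x : Fin d → Pt d) : Set (Pt d) := {y | side x y < 0}

/-- The law of `((X₁, …, X_d), Y)`, all `d + 1` points being drawn independently from `μ`. -/
def jointLaw {d : ℕ} (μ : Measure (Pt d)) : Measure ((Fin d → Pt d) × Pt d) :=
  (Measure.pi fun _ : Fin d => μ).prod μ

/-- The event that all `X_i` are in `A` and `Y` is in `B`. -/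
def inBoth {d : ℕ} (A B : Set (Pt d)) : Set ((Fin d → Pt d) × Pt d) :=
  {p | (∀ i, p.1 i ∈ A) ∧ p.2 ∈ B}

/-- Spatial divisibility of a distribution on `ℝ^d`: it has a density, and, given `X_i ∈ A` for
all `i` and `Y ∈ B`, the point `Y` falls with positive probability on either side of the hyperplane
through `X₁, …, X_d`. -/
structure SpatiallyDivisible {d : ℕ} (μ : Measure (Pt d)) : Prop where
  hasDensity : ∃ f : Pt d → ℝ≥0∞, Measurable f ∧ μ = volume.withDensity f
  divides : ∀ A B : Set (Pt d), MeasurableSet A → MeasurableSet B → 0 < μ A → 0 < μ B →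
    0 < (jointLaw μ)[{p | p.2 ∈ halfPos p.1} | inBoth A B] ∧
    0 < (jointLaw μ)[{p | p.2 ∈ halfNeg p.1} | inBoth A B]

/-! ### Randomized classification algorithms, loss and risk -/

/-- A randomized classification algorithm on `n` labelled training points: it maps the training
set and a decision string `r : Ω` to a classification function. -/
abbrev Algorithm (d n : ℕ) (Ω : Type) : Type := (Fin n → LPt d) → Ω → Pt d → Bool

section Risk

variable {d n : ℕ} {Ω : Type} [MeasurableSpace Ω]

/-- The loss of a trained randomized classifier at `z`: the probability, over the decision string
`r` with law `ρ`, that `z` is misclassified. -/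
def loss (ρ : Measure Ω) (cl : Ω → Pt d → Bool) (z : LPt d) : ℝ :=
  ρ.real {r | cl r z.1 ≠ z.2}

/-- The empirical risk: the average loss over the training set. -/
def empRisk (ρ : Measure Ω) (alg : Algorithm d n Ω) (S : Fin n → LPt d) : ℝ :=
  (1 / (n : ℝ)) * ∑ i, loss ρ (alg S) (S i)

/-- The law of a training set of `n` points drawn i.i.d. from `D`. -/
def sampleLaw (D : Measure (LPt d)) (n : ℕ) : Measure (Fin n → LPt d) :=
  Measure.pi fun _ => D

/-- The risk: the expected loss over the choice of the training set `S` and of an independent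
fresh point `z` drawn from `D`. -/
def risk (ρ : Measure Ω) (alg : Algorithm d n Ω) (D : Measure (LPt d)) : ℝ :=
  ∫ p : (Fin n → LPt d) × LPt d, loss ρ (alg p.1) p.2 ∂((sampleLaw D n).prod D)

end Risk

/-! ### The classifier FROCC -/

/-- A rule for shifting and scaling finite families of reals into `(0, 1)`: the family `v` is mapped
to `scale v * v i + shift v`. -/
structure Normalization where
  scale : ∀ {n : ℕ}, (Fin n → ℝ) → ℝ
  shift : ∀ {n : ℕ}, (Fin n → ℝ) → ℝ
  scale_pos : ∀ {n : ℕ} (v : Fin n → ℝ), 0 < scale v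
  mem_Ioo : ∀ {n : ℕ} (v : Fin n → ℝ) (i : Fin n), scale v * v i + shift v ∈ Set.Ioo (0 : ℝ) 1

/-- The shifted and scaled family in increasing order `y₁ ≤ ⋯ ≤ y_n`. -/
def Normalization.sorted (N : Normalization) {n : ℕ} (v : Fin n → ℝ) : Fin n → ℝ :=
  fun i => N.scale v * v (Tuple.sort v i) + N.shift v

/-- `[y j, y l]` is one of the `ε`-separated intervals of the increasing family `y`: consecutive
points inside are less than `ε` apart, and the neighbouring points outside are more than `ε`
away. -/
def IsInterval {n : ℕ} (ε : ℝ) (y : Fin n → ℝ) (j l : Fin n) : Prop :=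
  j ≤ l ∧
  (∀ s t : Fin n, j ≤ s → (t : ℕ) = s + 1 → t ≤ l → y t - y s < ε) ∧
  (∀ s : Fin n, (j : ℕ) = s + 1 → ε < y j - y s) ∧
  (∀ t : Fin n, (t : ℕ) = l + 1 → ε < y t - y l)

/-- The query value `q`, shifted and scaled like the training values `v`, lies within some
`ε`-separated interval. -/
def Accepts (N : Normalization) (ε : ℝ) {n : ℕ} (v : Fin n → ℝ) (q : ℝ) : Prop :=
  ∃ j l : Fin n, IsInterval ε (N.sorted v) j l ∧
    N.scale v * q + N.shift v ∈ Set.Icc (N.sorted v j) (N.sorted v l)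

open Classical in
/-- FROCC with `m` classifying directions, separation `ε` and kernel `K`: the decision string is the
family `w` of classifying directions, and the answer at `y` is YES (label `1`) if the projection of
`y` along every direction is accepted. Only the data part of the training points is used. -/
def frocc {d : ℕ} (N : Normalization) (m : ℕ) (ε : ℝ) (K : Pt d → Pt d → ℝ) (n : ℕ) :
    Algorithm d n (Fin m → Dir d) :=
  fun S w y => decide (∀ i : Fin m, Accepts N ε (fun j => K (w i) (S j).1) (K (w i) y))

/-- The uniform distribution on the unit vectors of `ℝ^d`. -/
def uniformDir (d : ℕ) : Measure (Dir d) :=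
  ((volume : Measure (Pt d)).toSphere Set.univ)⁻¹ • (volume : Measure (Pt d)).toSphere

/-- The law of `m` independent uniform classifying directions. -/
def dirLaw (d m : ℕ) : Measure (Fin m → Dir d) := Measure.pi fun _ => uniformDir d

end FROCC

end

namespace FROCC

/-! With separation `1` the values scaled into `(0, 1)` form one interval, so a query is accepted
iff in every direction its kernel value lies between the least and the greatest training value
(`accepts_one_iff`). Training points are thus never rejected, and the empirical risk is the
frequency of label `0` times the mass `M` of the direction law (`empRisk_frocc_eq`). A fresh point
is rejected only if it is a strict extreme among `n + 1` exchangeable values in one of `m`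
directions, so the risk is within `2 m / (n + 1)` of `M` times the probability of label `0`
(`abs_risk_frocc_sub_le`). Hoeffding's inequality for the labels gives the tail once `t` dominates
this bias; for smaller `t` the quantity `n t ^ 2` is bounded and a large constant suffices. -/

/-! ### Exchangeability and Hoeffding bounds -/

/-- Among `n + 1` independent draws, the last one is the strict minimiser of a statistic with
probability at most `1 / (n + 1)`. -/
theorem measure_strict_min_le {α : Type*} [MeasurableSpace α] (μ : Measure α)
    [IsProbabilityMeasure μ] {g : α → ℝ} (hg : Measurable g) (n : ℕ) :
    ((Measure.pi fun _ : Fin n => μ).prod μ) {p | ∀ j, g p.2 < g (p.1 j)} ≤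
      ((n : ℝ≥0∞) + 1)⁻¹ := by
  set q := ((Measure.pi fun _ : Fin n => μ).prod μ) {p | ∀ j, g p.2 < g (p.1 j)} with hq
  have hmeas : MeasurableSet {p : α × (Fin n → α) | ∀ j, g p.1 < g (p.2 j)} := by
    simp only [Set.ofPred_forall]
    exact .iInter fun j => measurableSet_lt (by fun_prop) (by fun_prop)
  -- Exchangeability: splitting off coordinate `k` turns the `(n + 1)`-fold product into `μ` times
  -- the `n`-fold one, whichever `k` is chosen.
  have hE : ∀ k : Fin (n + 1), (Measure.pi fun _ : Fin (n + 1) => μ)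
      {z | ∀ j, g (z k) < g (z (k.succAbove j))} = q := by
    intro k
    have h := (measurePreserving_piFinSuccAbove (fun _ : Fin (n + 1) => μ) k).measure_preimage
      hmeas.nullMeasurableSet
    rw [hq, ← Measure.prod_swap, Measure.map_apply measurable_swap]
    · exact h
    · simp only [Set.ofPred_forall]
      exact .iInter fun j => measurableSet_lt (by fun_prop) (by fun_prop)
  have hEm : ∀ k : Fin (n + 1),
      MeasurableSet {z : Fin (n + 1) → α | ∀ j, g (z k) < g (z (k.succAbove j))} := by
    intro k
    simp only [Set.ofPred_forall]
    exact .iInter fun j => measurableSet_lt (by fun_prop) (by fun_prop)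
  have hdis : Pairwise (Function.onFun Disjoint fun k : Fin (n + 1) =>
      {z : Fin (n + 1) → α | ∀ j, g (z k) < g (z (k.succAbove j))}) := by
    intro k l hkl
    refine Set.disjoint_left.2 fun z hz hz' => ?_
    obtain ⟨a, ha⟩ := Fin.exists_succAbove_eq hkl.symm
    obtain ⟨b, hb⟩ := Fin.exists_succAbove_eq hkl
    have h1 := hz a
    have h2 := hz' b
    rw [ha] at h1
    rw [hb] at h2
    exact lt_asymm h1 h2
  have hsum := measure_iUnion (μ := Measure.pi fun _ : Fin (n + 1) => μ) hdis hEm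
  simp only [hE, tsum_fintype, Finset.sum_const, Finset.card_univ, Fintype.card_fin,
    nsmul_eq_mul] at hsum
  have h1 : ((n + 1 : ℕ) : ℝ≥0∞) * q ≤ 1 := hsum ▸ prob_le_one
  rw [ENNReal.le_inv_iff_mul_le, mul_comm]
  exact_mod_cast h1

/-- Two-sided Hoeffding inequality for an i.i.d. sample of a `[0, 1]`-valued statistic. -/
theorem measureReal_abs_sum_sub_ge_le {α : Type*} [MeasurableSpace α] (μ : Measure α)
    [IsProbabilityMeasure μ] {f : α → ℝ} (hf : Measurable f) (h01 : ∀ x, f x ∈ Set.Icc (0 : ℝ) 1)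
    (n : ℕ) {ε : ℝ} (hε : 0 ≤ ε) :
    (Measure.pi fun _ : Fin n => μ).real {S | ε ≤ |∑ i, (f (S i) - ∫ x, f x ∂μ)|} ≤
      2 * Real.exp (-(2 * ε ^ 2 / n)) := by
  have hsub := hasSubgaussianMGF_of_mem_Icc (μ := μ) hf.aemeasurable (.of_forall h01)
  have hX : ∀ i : Fin n, HasSubgaussianMGF (fun S : Fin n → α => f (S i) - ∫ x, f x ∂μ)
      ((‖(1 : ℝ) - 0‖₊ / 2) ^ 2) (Measure.pi fun _ : Fin n => μ) := by
    intro i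
    have hev := measurePreserving_eval (fun _ : Fin n => μ) i
    refine HasSubgaussianMGF.of_map (Y := fun S : Fin n → α => S i)
      (X := fun x => f x - ∫ x, f x ∂μ) hev.measurable.aemeasurable ?_
    rw [hev.map_eq]
    exact hsub
  have hind : iIndepFun (fun i (S : Fin n → α) => f (S i) - ∫ x, f x ∂μ)
      (Measure.pi fun _ : Fin n => μ) :=
    iIndepFun_pi (X := fun _ x => f x - ∫ x, f x ∂μ)
      fun i => (hf.sub_const _).aemeasurable
  have hind' : iIndepFun (fun i => -fun (S : Fin n → α) => f (S i) - ∫ x, f x ∂μ)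
      (Measure.pi fun _ : Fin n => μ) :=
    hind.comp (fun _ x => -x) fun _ => measurable_neg
  have h1 := HasSubgaussianMGF.measure_sum_ge_le_of_iIndepFun hind
    (s := Finset.univ) (fun i _ => hX i) hε
  have h2 := HasSubgaussianMGF.measure_sum_ge_le_of_iIndepFun hind'
    (s := Finset.univ) (fun i _ => (hX i).neg) hε
  -- Each summand has variance proxy `1 / 4`; for `n = 0` both sides are zero by the convention on
  -- division.
  have hexp : -ε ^ 2 / (2 * ((∑ _i : Fin n, (‖(1 : ℝ) - 0‖₊ / 2) ^ 2 : NNReal) : ℝ)) =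
      -(2 * ε ^ 2 / n) := by
    rcases eq_or_ne (n : ℝ) 0 with h | h
    · simp [h]
    · simp
      field_simp
  rw [hexp] at h1 h2
  calc _ ≤ (Measure.pi fun _ : Fin n => μ).real
        ({S | ε ≤ ∑ i, (f (S i) - ∫ x, f x ∂μ)} ∪
          {S | ε ≤ ∑ i, (-fun S : Fin n → α => f (S i) - ∫ x, f x ∂μ) S}) := by
        refine measureReal_mono fun S hS => ?_
        rcases le_abs.1 (show ε ≤ |_| from hS) with h | h
        · exact .inl h
        · refine .inr ?_
          simpa [Finset.sum_neg_distrib] using h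
    _ ≤ _ := measureReal_union_le _ _
    _ ≤ _ := by linarith

/-! ### FROCC at separation `1` -/

/-- With separation `1` all training values form a single interval, so a query value is accepted
exactly when it lies between two training values. -/
theorem accepts_one_iff (N : Normalization) {n : ℕ} (v : Fin n → ℝ) (q : ℝ) :
    Accepts N 1 v q ↔ (∃ j, v j ≤ q) ∧ ∃ l, q ≤ v l := by
  have hs := N.scale_pos v
  constructor
  · rintro ⟨j, l, -, h1, h2⟩
    refine ⟨⟨Tuple.sort v j, ?_⟩, Tuple.sort v l, ?_⟩
    · exact le_of_mul_le_mul_left (by simpa [Normalization.sorted] using h1) hs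
    · exact le_of_mul_le_mul_left (by simpa [Normalization.sorted] using h2) hs
  · rintro ⟨⟨j, hj⟩, l, hl⟩
    obtain ⟨n, rfl⟩ : ∃ k, n = k + 1 := Nat.exists_eq_succ_of_ne_zero (by
      rintro rfl; exact j.elim0)
    have hmem (i : Fin (n + 1)) : N.sorted v i ∈ Set.Ioo (0 : ℝ) 1 := N.mem_Ioo v _
    have hmono := Tuple.monotone_sort v
    have hmin : v (Tuple.sort v 0) ≤ v j := by
      simpa using hmono (Fin.zero_le ((Tuple.sort v).symm j))
    have hmax : v l ≤ v (Tuple.sort v (Fin.last n)) := by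
      simpa using hmono (Fin.le_last ((Tuple.sort v).symm l))
    -- The full range qualifies: gaps inside `(0, 1)` are below `1`, and there are no outer
    -- neighbours.
    refine ⟨0, Fin.last n, ⟨Fin.zero_le _, fun s t _ _ _ => ?_, fun s hs => ?_, fun t ht => ?_⟩,
      ?_, ?_⟩
    · linarith [(hmem t).2, (hmem s).1]
    · simp at hs
    · have := t.2
      simp at ht
      omega
    · have := mul_le_mul_of_nonneg_left (hmin.trans hj) hs.le
      simpa [Normalization.sorted] using this
    · have := mul_le_mul_of_nonneg_left (hl.trans hmax) hs.le
      simpa [Normalization.sorted] using this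

theorem frocc_one_eq_true_iff {d m n : ℕ} (N : Normalization) (K : Pt d → Pt d → ℝ)
    (S : Fin n → LPt d) (w : Fin m → Dir d) (y : Pt d) :
    frocc N m 1 K n S w y = true ↔
      ∀ i, (∃ j, K (w i) (S j).1 ≤ K (w i) y) ∧ ∃ l, K (w i) y ≤ K (w i) (S l).1 := by
  simp [frocc, accepts_one_iff]

theorem frocc_one_self {d m n : ℕ} (N : Normalization) (K : Pt d → Pt d → ℝ)
    (S : Fin n → LPt d) (w : Fin m → Dir d) (k : Fin n) :
    frocc N m 1 K n S w (S k).1 = true :=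
  (frocc_one_eq_true_iff N K S w _).2 fun _ => ⟨⟨k, le_rfl⟩, k, le_rfl⟩

/-- For `d = 0` the sphere is empty and this measure is zero, so the argument uses only total mass
at most `1`. -/
instance isFiniteMeasure_uniformDir (d : ℕ) : IsFiniteMeasure (uniformDir d) := by
  refine ⟨lt_of_le_of_lt ?_ ENNReal.one_lt_top⟩
  simp only [uniformDir, Measure.smul_apply, smul_eq_mul]
  exact ENNReal.inv_mul_le_one _

instance isFiniteMeasure_dirLaw (d m : ℕ) : IsFiniteMeasure (dirLaw d m) := by
  unfold dirLaw; infer_instance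

theorem dirLaw_univ_le_one (d m : ℕ) : dirLaw d m Set.univ ≤ 1 := by
  simp only [dirLaw, Measure.pi_univ]
  refine Finset.prod_le_one' fun i _ => ?_
  simp only [uniformDir, Measure.smul_apply, smul_eq_mul]
  exact ENNReal.inv_mul_le_one _

instance isProbabilityMeasure_sampleLaw {d : ℕ} (D : Measure (LPt d)) [IsProbabilityMeasure D]
    (n : ℕ) : IsProbabilityMeasure (sampleLaw D n) := by
  unfold sampleLaw; infer_instance

/-! ### Probability of rejecting a fresh point -/

/-- The event that the query, the last component of the sample, is rejected. -/
def rejected {d : ℕ} (N : Normalization) (m : ℕ) (K : Pt d → Pt d → ℝ) (n : ℕ) :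
    Set (((Fin n → LPt d) × LPt d) × (Fin m → Dir d)) :=
  {p | frocc N m 1 K n p.1.1 p.2 p.1.2.1 = false}

theorem rejected_eq {d m n : ℕ} (N : Normalization) (K : Pt d → Pt d → ℝ) :
    rejected N m K n =
      ⋃ i, ({p | ∀ j, K (p.2 i) p.1.2.1 < K (p.2 i) (p.1.1 j).1} ∪
        {p | ∀ j, K (p.2 i) (p.1.1 j).1 < K (p.2 i) p.1.2.1}) := by
  ext p
  simp only [rejected, Set.mem_ofPred_eq, Set.mem_iUnion, Set.mem_union]
  rw [← Bool.not_eq_true, frocc_one_eq_true_iff]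
  simp only [not_forall, not_and_or, not_exists, not_le]

section Rejection

variable {d m n : ℕ} {K : Pt d → Pt d → ℝ}

theorem measurableSet_query_lt (hK : Measurable (Function.uncurry K)) (i : Fin m) :
    MeasurableSet {p : ((Fin n → LPt d) × LPt d) × (Fin m → Dir d) |
      ∀ j, K (p.2 i) p.1.2.1 < K (p.2 i) (p.1.1 j).1} := by
  simp only [Set.ofPred_forall]
  refine .iInter fun j => measurableSet_lt ?_ ?_
  · exact hK.comp (by fun_prop : Measurable fun p : ((Fin n → LPt d) × LPt d) × (Fin m → Dir d) =>
      ((p.2 i : Pt d), p.1.2.1))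
  · exact hK.comp (by fun_prop : Measurable fun p : ((Fin n → LPt d) × LPt d) × (Fin m → Dir d) =>
      ((p.2 i : Pt d), (p.1.1 j).1))

theorem measurableSet_lt_query (hK : Measurable (Function.uncurry K)) (i : Fin m) :
    MeasurableSet {p : ((Fin n → LPt d) × LPt d) × (Fin m → Dir d) |
      ∀ j, K (p.2 i) (p.1.1 j).1 < K (p.2 i) p.1.2.1} := by
  have h := measurableSet_query_lt (n := n) (K := fun x y => -K x y) hK.neg i
  simpa only [neg_lt_neg_iff] using h

theorem measurableSet_rejected (N : Normalization) (hK : Measurable (Function.uncurry K)) :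
    MeasurableSet (rejected N m K n) := by
  rw [rejected_eq]
  exact .iUnion fun i => (measurableSet_query_lt hK i).union (measurableSet_lt_query hK i)

variable (D : Measure (LPt d)) [IsProbabilityMeasure D]

/-- By Fubini the directions can be frozen; `K (w i)` is then a fixed statistic of i.i.d. points,
and `measure_strict_min_le` applies. -/
theorem measure_query_lt_le (hK : Measurable (Function.uncurry K)) (i : Fin m) :
    (((sampleLaw D n).prod D).prod (dirLaw d m))
      {p | ∀ j, K (p.2 i) p.1.2.1 < K (p.2 i) (p.1.1 j).1} ≤ ((n : ℝ≥0∞) + 1)⁻¹ := by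
  rw [Measure.prod_apply_symm (measurableSet_query_lt hK i)]
  calc _ ≤ ∫⁻ _w, ((n : ℝ≥0∞) + 1)⁻¹ ∂(dirLaw d m) := by
        refine lintegral_mono fun w => ?_
        have hg : Measurable fun z : LPt d => K (w i) z.1 :=
          hK.comp (by fun_prop : Measurable fun z : LPt d => ((w i : Pt d), z.1))
        exact measure_strict_min_le D hg n
    _ ≤ _ := by
        rw [lintegral_const]
        exact mul_le_of_le_one_right' (dirLaw_univ_le_one d m)

/-- Replacing `K` by `-K` exchanges maxima and minima. -/
theorem measure_lt_query_le (hK : Measurable (Function.uncurry K)) (i : Fin m) :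
    (((sampleLaw D n).prod D).prod (dirLaw d m))
      {p | ∀ j, K (p.2 i) (p.1.1 j).1 < K (p.2 i) p.1.2.1} ≤ ((n : ℝ≥0∞) + 1)⁻¹ := by
  have h := measure_query_lt_le (n := n) (K := fun x y => -K x y) D hK.neg i
  simpa only [neg_lt_neg_iff] using h

/-- A fresh point is rejected with probability at most `2 m / (n + 1)`. -/
theorem measureReal_rejected_le (N : Normalization) (hK : Measurable (Function.uncurry K)) :
    (((sampleLaw D n).prod D).prod (dirLaw d m)).real (rejected N m K n) ≤ 2 * m / (n + 1) := by
  have h : (((sampleLaw D n).prod D).prod (dirLaw d m)) (rejected N m K n) ≤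
      ∑ _i : Fin m, (((n : ℝ≥0∞) + 1)⁻¹ + ((n : ℝ≥0∞) + 1)⁻¹) := by
    rw [rejected_eq]
    refine (measure_iUnion_fintype_le _ _).trans (Finset.sum_le_sum fun i _ => ?_)
    exact (measure_union_le _ _).trans
      (add_le_add (measure_query_lt_le D hK i) (measure_lt_query_le D hK i))
  refine (ENNReal.toReal_mono (by simp [ENNReal.mul_eq_top]) h).trans_eq ?_
  have hn : ((n : ℝ≥0∞) + 1)⁻¹.toReal = ((n : ℝ) + 1)⁻¹ := by
    rw [ENNReal.toReal_inv]
    exact_mod_cast congrArg Inv.inv (ENNReal.toReal_natCast (n + 1))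
  rw [Finset.sum_const, nsmul_eq_mul, ENNReal.toReal_mul, ← two_mul, ENNReal.toReal_mul, hn]
  simp
  ring

end Rejection


/-! ### Loss, risk and concentration -/

/-- The indicator of label `0`. -/
def negLabel {d : ℕ} (z : LPt d) : ℝ := if z.2 then 0 else 1

theorem measurable_negLabel {d : ℕ} : Measurable (negLabel (d := d)) :=
  (measurable_of_finite fun b : Bool => if b then (0 : ℝ) else 1).comp measurable_snd

theorem negLabel_mem_Icc {d : ℕ} (z : LPt d) : negLabel z ∈ Set.Icc (0 : ℝ) 1 := by
  unfold negLabel; split_ifs <;> simp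

section Risk

variable {d m n : ℕ} {K : Pt d → Pt d → ℝ}

theorem dirLaw_real_univ_le_one (d m : ℕ) : (dirLaw d m).real Set.univ ≤ 1 :=
  ENNReal.toReal_le_of_le_ofReal zero_le_one (by simpa using dirLaw_univ_le_one d m)

theorem measurableSet_rejected_section (N : Normalization) (hK : Measurable (Function.uncurry K))
    (p : (Fin n → LPt d) × LPt d) :
    MeasurableSet {w : Fin m → Dir d | (p, w) ∈ rejected N m K n} :=
  measurable_prodMk_left (measurableSet_rejected N hK)

theorem loss_frocc_of_true (N : Normalization) (S : Fin n → LPt d) (z : LPt d)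
    (hz : z.2 = true) :
    loss (dirLaw d m) (frocc N m 1 K n S) z =
      (dirLaw d m).real {w | ((S, z), w) ∈ rejected N m K n} := by
  simp [loss, rejected, hz]

theorem loss_frocc_of_false (N : Normalization) (hK : Measurable (Function.uncurry K))
    (S : Fin n → LPt d) (z : LPt d) (hz : z.2 = false) :
    loss (dirLaw d m) (frocc N m 1 K n S) z =
      (dirLaw d m).real Set.univ -
        (dirLaw d m).real {w | ((S, z), w) ∈ rejected N m K n} := by
  rw [← measureReal_compl (measurableSet_rejected_section N hK (S, z))]
  simp only [loss, hz]
  rfl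

theorem measurable_rejected_prob (N : Normalization) (hK : Measurable (Function.uncurry K)) :
    Measurable fun p : (Fin n → LPt d) × LPt d =>
      (dirLaw d m).real {w | (p, w) ∈ rejected N m K n} :=
  (measurable_measure_prodMk_left (measurableSet_rejected N hK)).ennreal_toReal

/-- The loss is a label-dependent combination of the total mass and the rejection probability. -/
theorem loss_frocc_eq (N : Normalization) (hK : Measurable (Function.uncurry K))
    (p : (Fin n → LPt d) × LPt d) :
    loss (dirLaw d m) (frocc N m 1 K n p.1) p.2 =
      (dirLaw d m).real Set.univ * negLabel p.2 + (1 - 2 * negLabel p.2) *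
        (dirLaw d m).real {w | (p, w) ∈ rejected N m K n} := by
  cases h : p.2.2
  · rw [loss_frocc_of_false N hK _ _ h]
    simp only [negLabel, h, Bool.false_eq_true, if_false]
    ring
  · rw [loss_frocc_of_true N _ _ h]
    simp [negLabel, h]

variable (D : Measure (LPt d)) [IsProbabilityMeasure D]

theorem integrable_loss_frocc (N : Normalization) (hK : Measurable (Function.uncurry K)) :
    Integrable (fun p : (Fin n → LPt d) × LPt d =>
      loss (dirLaw d m) (frocc N m 1 K n p.1) p.2) ((sampleLaw D n).prod D) := by
  refine Integrable.of_mem_Icc 0 1 ?_ (.of_forall fun p => ⟨measureReal_nonneg, ?_⟩)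
  · simp only [loss_frocc_eq N hK]
    have h1 := measurable_rejected_prob (m := m) (n := n) N hK
    have h2 := measurable_negLabel (d := d)
    exact Measurable.aemeasurable (by fun_prop)
  · exact (measureReal_mono (Set.subset_univ _)).trans (dirLaw_real_univ_le_one d m)

/-- Since training points are always accepted, their loss depends on the label alone; this makes the
empirical risk an i.i.d. average despite the classifier's dependence on `S`. -/
theorem empRisk_frocc_eq (N : Normalization) (S : Fin n → LPt d) :
    empRisk (dirLaw d m) (frocc N m 1 K n) S =
      (dirLaw d m).real Set.univ * ((1 / (n : ℝ)) * ∑ i, negLabel (S i)) := by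
  have h (i : Fin n) : loss (dirLaw d m) (frocc N m 1 K n S) (S i) =
      (dirLaw d m).real Set.univ * negLabel (S i) := by
    cases hi : (S i).2 <;> simp [loss, frocc_one_self, negLabel, hi]
  simp only [empRisk, h, ← Finset.mul_sum]
  ring

/-- Up to `2 m / (n + 1)`, the risk is the probability of label `0`. -/
theorem abs_risk_frocc_sub_le (N : Normalization) (hK : Measurable (Function.uncurry K)) :
    |risk (dirLaw d m) (frocc N m 1 K n) D -
      (dirLaw d m).real Set.univ * ∫ z, negLabel z ∂D| ≤ 2 * m / (n + 1) := by
  have hint : Integrable (negLabel (d := d)) D :=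
    Integrable.of_mem_Icc 0 1 measurable_negLabel.aemeasurable (.of_forall negLabel_mem_Icc)
  have hsnd : ∫ z, negLabel z ∂D =
      ∫ p : (Fin n → LPt d) × LPt d, negLabel p.2 ∂((sampleLaw D n).prod D) := by
    rw [integral_fun_snd (μ := sampleLaw D n) (ν := D) negLabel]
    simp
  have hrej : ∫ p : (Fin n → LPt d) × LPt d, (dirLaw d m).real {w | (p, w) ∈ rejected N m K n}
      ∂((sampleLaw D n).prod D) =
      (((sampleLaw D n).prod D).prod (dirLaw d m)).real (rejected N m K n) := by
    rw [measureReal_def, Measure.prod_apply (measurableSet_rejected N hK)]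
    exact integral_toReal
      (measurable_measure_prodMk_left (measurableSet_rejected N hK)).aemeasurable
      (.of_forall fun p => measure_lt_top _ _)
  have hrint : Integrable (fun p : (Fin n → LPt d) × LPt d =>
      (dirLaw d m).real {w | (p, w) ∈ rejected N m K n}) ((sampleLaw D n).prod D) :=
    Integrable.of_mem_Icc 0 1 (measurable_rejected_prob N hK).aemeasurable
      (.of_forall fun p => ⟨measureReal_nonneg,
        (measureReal_mono (Set.subset_univ _)).trans (dirLaw_real_univ_le_one d m)⟩)
  rw [risk, hsnd, ← integral_const_mul, ← integral_sub (integrable_loss_frocc D N hK)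
    ((hint.comp_snd _).const_mul _), ← Real.norm_eq_abs]
  refine (norm_integral_le_of_norm_le hrint (.of_forall fun p => ?_)).trans
    (hrej.trans_le (measureReal_rejected_le D N hK))
  rw [loss_frocc_eq N hK, add_sub_cancel_left, norm_mul]
  refine mul_le_of_le_one_left (norm_nonneg _) ?_ |>.trans_eq
    (Real.norm_of_nonneg measureReal_nonneg)
  rw [Real.norm_eq_abs, abs_le]
  constructor <;> linarith [(negLabel_mem_Icc p.2).1, (negLabel_mem_Icc p.2).2]

/-- Above the scale `4 m / (n + 1)`, the deviation of the empirical risk from the risk obeys a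
Hoeffding bound. -/
theorem measureReal_abs_empRisk_sub_risk_le (N : Normalization)
    (hK : Measurable (Function.uncurry K)) (hn : 1 ≤ n) {t : ℝ} (ht : 0 < t)
    (hmt : 4 * m / (n + 1) ≤ t) :
    (sampleLaw D n).real {S | t < |empRisk (dirLaw d m) (frocc N m 1 K n) S -
      risk (dirLaw d m) (frocc N m 1 K n) D|} ≤ 2 * Real.exp (-(1 / 2 * n * t ^ 2)) := by
  have hn0 : (0 : ℝ) < n := by exact_mod_cast hn
  -- Half of `t` absorbs the bias `2 m / (n + 1)`; the other half is left for the label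
  -- fluctuations.
  have hH := measureReal_abs_sum_sub_ge_le D measurable_negLabel negLabel_mem_Icc n
    (ε := n * (t / 2)) (by positivity)
  rw [show 2 * (n * (t / 2)) ^ 2 / (n : ℝ) = 1 / 2 * n * t ^ 2 by field_simp] at hH
  refine (measureReal_mono fun S hS => ?_).trans hH
  simp only [Set.mem_ofPred_eq] at hS ⊢
  have hr := abs_risk_frocc_sub_le (m := m) (n := n) D N hK
  have hM1 := dirLaw_real_univ_le_one d m
  have hM0 : 0 ≤ (dirLaw d m).real Set.univ := measureReal_nonneg
  set M := (dirLaw d m).real Set.univ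
  set p := ∫ z, negLabel z ∂D
  have hdev : empRisk (dirLaw d m) (frocc N m 1 K n) S - M * p =
      M * ((1 / (n : ℝ)) * ∑ i, (negLabel (S i) - p)) := by
    rw [empRisk_frocc_eq, Finset.sum_sub_distrib, Finset.sum_const, Finset.card_univ,
      Fintype.card_fin, nsmul_eq_mul]
    field_simp
    ring
  have hle : |empRisk (dirLaw d m) (frocc N m 1 K n) S - M * p| ≤
      (1 / (n : ℝ)) * |∑ i, (negLabel (S i) - p)| := by
    rw [hdev, abs_mul, abs_mul, abs_of_nonneg hM0, abs_of_pos (by positivity : 0 < 1 / (n : ℝ))]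
    exact mul_le_of_le_one_left (by positivity) hM1
  have htri := abs_sub_le (empRisk (dirLaw d m) (frocc N m 1 K n) S) (M * p)
    (risk (dirLaw d m) (frocc N m 1 K n) D)
  rw [abs_sub_comm (M * p)] at htri
  have hhalf : t / 2 ≤ (1 / (n : ℝ)) * |∑ i, (negLabel (S i) - p)| := by
    have : (4 * m / (n + 1) : ℝ) = 2 * (2 * m / (n + 1)) := by ring
    linarith
  rw [one_div, inv_mul_eq_div, le_div_iff₀ hn0] at hhalf
  linarith

end Risk

end FROCC

theorem theorem2 (d m : ℕ) (hm : 0 < m) (K : FROCC.Pt d → FROCC.Pt d → ℝ)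
    (hK : Measurable (Function.uncurry K)) (N : FROCC.Normalization)
    (D : Measure (FROCC.LPt d)) [IsProbabilityMeasure D]
    (hD : FROCC.SpatiallyDivisible (D.map Prod.fst)) :
    (∀ n : ℕ, 1 ≤ n →
      Integrable (fun p : (Fin n → FROCC.LPt d) × FROCC.LPt d =>
        FROCC.loss (FROCC.dirLaw d m) (FROCC.frocc N m 1 K n p.1) p.2)
        ((FROCC.sampleLaw D n).prod D)) ∧
    ∃ C c : ℝ, 0 < C ∧ 0 < c ∧ ∀ n : ℕ, 1 ≤ n → ∀ t : ℝ, 0 < t →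
      (FROCC.sampleLaw D n).real
        {S | t < |FROCC.empRisk (FROCC.dirLaw d m) (FROCC.frocc N m 1 K n) S -
              FROCC.risk (FROCC.dirLaw d m) (FROCC.frocc N m 1 K n) D|} ≤
        C * Real.exp (-(c * n * t ^ 2)) := by
  -- The factor `2` and the rate `1 / 2` come from Hoeffding at `t / 2`. When `t (n + 1) ≤ 4 m`, one
  -- has `n t ^ 2 / 2 ≤ 8 m ^ 2`, so `exp (8 m ^ 2)` makes the bound trivial.
  refine ⟨fun n _ => FROCC.integrable_loss_frocc D N hK,
    2 * Real.exp (8 * m ^ 2), 1 / 2, by positivity, by norm_num, fun n hn t ht => ?_⟩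
  rcases le_total (4 * m / (n + 1) : ℝ) t with h | h
  · refine (FROCC.measureReal_abs_empRisk_sub_risk_le D N hK hn ht h).trans ?_
    gcongr
    exact le_mul_of_one_le_right (by norm_num) (Real.one_le_exp (by positivity))
  · refine measureReal_le_one.trans ?_
    rw [mul_assoc, ← Real.exp_add]
    have hn0 : (1 : ℝ) ≤ n := by exact_mod_cast hn
    rw [le_div_iff₀ (by positivity)] at h
    have h2 : (t * (n + 1)) ^ 2 ≤ (4 * m) ^ 2 := by gcongr
    have h3 : n * t ^ 2 ≤ (t * (n + 1)) ^ 2 := by nlinarith [sq_nonneg t, sq_nonneg (t * n)]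
    have h1 : 1 ≤ Real.exp (8 * m ^ 2 + -(1 / 2 * n * t ^ 2)) := Real.one_le_exp (by linarith)
    linarith
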